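/- In ZFC, there exists a homogeneous subspace $X$ of the Cantor set $2^\omega$ whose complement $2^\omega\setminus X$ is dense in $2^\omega$ and rigid. Here $2^\omega$ carries the product topology and subsets carry the subspace topology; a space $S$ is homogeneous if for all $x,y\in S$ there is a homeomorphism $h\colon S\to S$ with $h(x)=y$, and rigid if the identity is its only self-homeomorphism. -/

import Mathlib

/-- A topological space is homogeneous if for every pair `(x, y)` of its points some
self-homeomorphism maps `x` to `y`. -/
def TopHomogeneous (X : Type*) [TopologicalSpace X] : Prop :=
  ∀ x y : X, ∃ h : X ≃ₜ X, h x = y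

/-- A topological space is rigid if the identity is its only self-homeomorphism. -/
def TopRigid (X : Type*) [TopologicalSpace X] : Prop :=
  ∀ h : X ≃ₜ X, h = Homeomorph.refl X

/-! Let `N` be the group of sequences over a countable ordered field `A` (in the end a discrete `ℚ`)
and let `Q = polySeq A`, a countable dense subgroup. Any union `X` of cosets of `Q` is homogeneous:
to send `f` to `g`, translate the points first differing from `f` at place `m` by some `q m ∈ Q`
that agrees with `g - f` through `m` (`topHomogeneous_of_dense_translations`). An embedding `E` of
`N` with dense range and countable remainder carries `X` into the Cantor set.

The cosets are chosen by transfinite recursion against all nonempty closed relations on the Cantor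
set, each coded by a sequence dense in it (`exists_splitting_set`). Suppose a homeomorphism `φ` of
the complement moves a point, and let `R` be the closure of its graph over an open set of moved
points. The choice of `X` leaves only countably many strict pairs of `R` in different cosets, so by
Baire category an open piece of the strict pairs is one point or lies on the graph of a translation
by some `q ∈ Q`. A single point is impossible because the complement of `X` is everywhere
uncountable, and `q = 0` because `φ` moves the points. For `q ≠ 0`, `φ` is defined and continuous at
the remainder points, while translation by `q` oscillates at some of them: the encoding records
signs, and these are unstable under translation (`infinite_sign_change`, `exists_oscillation`).
`topRigid_compl_image` combines these arguments. -/

/-! ### Encoding sequences of blocks as points of the Cantor set -/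

/-- The index of the block containing position `k`, and the offset within that block, when the
block of `a : Bool × ℕ` has length `a.2 + 2`. -/
def blockState (F : ℕ → Bool × ℕ) : ℕ → ℕ × ℕ
  | 0 => (0, 0)
  | k + 1 =>
    if (blockState F k).2 = (F (blockState F k).1).2 + 1 then ((blockState F k).1 + 1, 0)
    else ((blockState F k).1, (blockState F k).2 + 1)

/-- The block of `(b, e)` is the bit `b`, followed by `e` times `false` and one `true`. -/
def blockBit (a : Bool × ℕ) (j : ℕ) : Bool := if j = 0 then a.1 else decide (j = a.2 + 1)

/-- The concatenation of the blocks of `F 0, F 1, …`. -/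
def blockEnc (F : ℕ → Bool × ℕ) (k : ℕ) : Bool :=
  blockBit (F (blockState F k).1) (blockState F k).2

/-- The position at which the `n`-th block starts. -/
def blockStart (F : ℕ → Bool × ℕ) (n : ℕ) : ℕ := ∑ i ∈ Finset.range n, ((F i).2 + 2)

lemma blockStart_succ (F : ℕ → Bool × ℕ) (n : ℕ) :
    blockStart F (n + 1) = blockStart F n + ((F n).2 + 2) := by
  simp [blockStart, Finset.sum_range_succ]

lemma le_blockStart (F : ℕ → Bool × ℕ) (n : ℕ) : n ≤ blockStart F n := by
  induction n with
  | zero => simp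
  | succ n ih => rw [blockStart_succ]; omega

lemma blockStart_congr {F G : ℕ → Bool × ℕ} {n : ℕ} (h : ∀ i < n, F i = G i) :
    blockStart F n = blockStart G n :=
  Finset.sum_congr rfl fun i hi => by rw [h i (Finset.mem_range.1 hi)]

lemma blockState_start_add (F : ℕ → Bool × ℕ) (n j : ℕ) (hj : j ≤ (F n).2 + 1) :
    blockState F (blockStart F n + j) = (n, j) := by
  have step : ∀ n, blockState F (blockStart F n) = (n, 0) → ∀ j, j ≤ (F n).2 + 1 →
      blockState F (blockStart F n + j) = (n, j) := by
    intro n h0 j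
    induction j with
    | zero => intro _; exact h0
    | succ j ih =>
      intro hj
      rw [← add_assoc, blockState, ih (by omega)]
      simp only
      rw [if_neg (by omega)]
  refine step n ?_ j hj
  clear hj
  induction n with
  | zero => rfl
  | succ n ih =>
    have : blockStart F (n + 1) = blockStart F n + ((F n).2 + 1) + 1 := by
      rw [blockStart_succ]; ring
    rw [this, blockState, step n ih _ le_rfl]
    simp

lemma blockEnc_start_add (F : ℕ → Bool × ℕ) (n j : ℕ) (hj : j ≤ (F n).2 + 1) :
    blockEnc F (blockStart F n + j) = blockBit (F n) j := by
  rw [blockEnc, blockState_start_add F n j hj]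

lemma blockEnc_start (F : ℕ → Bool × ℕ) (n : ℕ) : blockEnc F (blockStart F n) = (F n).1 := by
  simpa [blockBit] using blockEnc_start_add F n 0 (Nat.zero_le _)

lemma blockEnc_start_add_succ (F : ℕ → Bool × ℕ) (n j : ℕ) (hj : j ≤ (F n).2) :
    blockEnc F (blockStart F n + 1 + j) = decide (j = (F n).2) := by
  rw [add_assoc, blockEnc_start_add F n _ (by omega)]
  simp [blockBit, add_comm 1 j]

lemma exists_blockStart_add (F : ℕ → Bool × ℕ) (m k : ℕ) (hk : k < blockStart F m) :
    ∃ n < m, ∃ j ≤ (F n).2 + 1, k = blockStart F n + j := by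
  induction m with
  | zero => simp [blockStart] at hk
  | succ m ih =>
    by_cases h : k < blockStart F m
    · obtain ⟨n, hn, j, hj, rfl⟩ := ih h
      exact ⟨n, by omega, j, hj, rfl⟩
    · rw [blockStart_succ] at hk
      exact ⟨m, by omega, k - blockStart F m, by omega, by omega⟩

lemma blockEnc_congr {F G : ℕ → Bool × ℕ} {m k : ℕ} (h : ∀ i < m, F i = G i)
    (hk : k < blockStart F m) : blockEnc F k = blockEnc G k := by
  obtain ⟨n, hn, j, hj, rfl⟩ := exists_blockStart_add F m k hk
  rw [blockEnc_start_add F n j hj, blockStart_congr fun i hi => h i (hi.trans hn),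
    blockEnc_start_add G n j (h n hn ▸ hj), h n hn]

/-- A block sequence is determined by its encoding, with a modulus of continuity. -/
lemma eq_of_blockEnc_eq {F G : ℕ → Bool × ℕ} (n : ℕ)
    (h : ∀ k < blockStart F n, blockEnc F k = blockEnc G k) : ∀ i < n, F i = G i := by
  induction n with
  | zero => simp
  | succ n ih =>
    rw [blockStart_succ] at h
    have ih' := ih fun k hk => h k (by omega)
    have hs := blockStart_congr ih'
    have hn : F n = G n := by
      have h1 := h (blockStart F n) (by omega)
      rw [blockEnc_start, hs, blockEnc_start] at h1
      refine Prod.ext h1 ?_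
      by_contra hne
      rcases lt_or_gt_of_ne hne with hlt | hlt
      · have h2 := h (blockStart F n + 1 + (F n).2) (by omega)
        rw [blockEnc_start_add_succ F n _ le_rfl, hs, blockEnc_start_add_succ G n _ hlt.le] at h2
        simp [hne] at h2
      · have h2 := h (blockStart F n + 1 + (G n).2) (by omega)
        rw [blockEnc_start_add_succ F n _ hlt.le, hs, blockEnc_start_add_succ G n _ le_rfl] at h2
        simp [Ne.symm hne] at h2
    intro i hi
    rcases Nat.lt_succ_iff_lt_or_eq.1 hi with hi | rfl
    · exact ih' i hi
    · exact hn

lemma blockEnc_injective : Function.Injective blockEnc := fun _ _ h =>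
  funext fun n => eq_of_blockEnc_eq (n + 1) (fun k _ => congrFun h k) n n.lt_succ_self

/-- Prefix neighbourhoods form a basis of a countable product of discrete spaces. -/
lemma exists_prefix_subset {B : Type*} [TopologicalSpace B] [DiscreteTopology B] {U : Set (ℕ → B)}
    (hU : IsOpen U) {x : ℕ → B} (hx : x ∈ U) : ∃ n, ∀ y : ℕ → B, (∀ i < n, y i = x i) → y ∈ U := by
  obtain ⟨I, u, hu, hI⟩ := isOpen_pi_iff.1 hU x hx
  refine ⟨I.sup id + 1, fun y hy => hI fun i hi => ?_⟩
  have hi' : i ≤ I.sup id := Finset.le_sup (f := id) hi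
  simp only [hy i (by omega)]
  exact (hu i hi).2

lemma isOpen_prefix {B : Type*} [TopologicalSpace B] [DiscreteTopology B] (x : ℕ → B) (n : ℕ) :
    IsOpen {y : ℕ → B | ∀ i < n, y i = x i} := by
  have : {y : ℕ → B | ∀ i < n, y i = x i} = ⋂ i ∈ Set.Iio n, (fun y => y i) ⁻¹' {x i} := by
    ext; simp
  rw [this]
  exact (Set.finite_Iio n).isOpen_biInter fun i _ =>
    (isOpen_discrete _).preimage (continuous_apply i)

lemma continuous_of_prefix {B C : Type*} [TopologicalSpace B] [DiscreteTopology B]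
    [TopologicalSpace C] {h : (ℕ → B) → ℕ → C}
    (H : ∀ x i, ∃ n, ∀ y : ℕ → B, (∀ j < n, y j = x j) → h y i = h x i) : Continuous h := by
  refine continuous_pi fun i => continuous_iff_continuousAt.2 fun x => ?_
  obtain ⟨n, hn⟩ := H x i
  have : (fun y => h y i) =ᶠ[nhds x] fun _ => h x i :=
    Filter.mem_of_superset ((isOpen_prefix x n).mem_nhds fun _ _ => rfl) hn
  exact continuousAt_const.congr this.symm

lemma isEmbedding_blockEnc : Topology.IsEmbedding blockEnc := by
  have hc : Continuous blockEnc := continuous_of_prefix fun F k =>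
    ⟨k + 1, fun G hG => (blockEnc_congr (m := k + 1) (fun i hi => (hG i hi).symm)
      (Nat.lt_of_lt_of_le k.lt_succ_self (le_blockStart _ _))).symm⟩
  refine ⟨Topology.isInducing_iff_nhds.2 fun F => le_antisymm (hc.tendsto F).le_comap ?_,
    blockEnc_injective⟩
  intro S hS
  obtain ⟨U, hUS, hU, hF⟩ := mem_nhds_iff.1 hS
  obtain ⟨n, hn⟩ := exists_prefix_subset hU hF
  refine ⟨_, (isOpen_prefix (blockEnc F) (blockStart F n)).mem_nhds fun _ _ => rfl, ?_⟩
  intro G hG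
  exact hUS (hn G fun i hi => (eq_of_blockEnc_eq n (fun k hk => (hG k hk).symm) i hi).symm)

lemma exists_blockEnc_eq_true (F : ℕ → Bool × ℕ) (m : ℕ) : ∃ k ≥ m, blockEnc F k = true :=
  ⟨blockStart F m + 1 + (F m).2, by have := le_blockStart F m; omega, by
    simp [blockEnc_start_add_succ F m _ le_rfl]⟩

/-- Greedy decoding: read one bit, search for the next `true`, and start a new block right after it.
-/
lemma mem_range_blockEnc {x : ℕ → Bool} (hx : ∀ m, ∃ k ≥ m, x k = true) :
    x ∈ Set.range blockEnc := by
  have hx' : ∀ m, ∃ e, x (m + 1 + e) = true := fun m => by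
    obtain ⟨k, hk, h⟩ := hx (m + 1)
    exact ⟨k - (m + 1), by rwa [Nat.add_sub_cancel' hk]⟩
  let p : ℕ → ℕ := fun n => Nat.rec 0 (fun _ m => m + (Nat.find (hx' m) + 2)) n
  let F : ℕ → Bool × ℕ := fun n => (x (p n), Nat.find (hx' (p n)))
  have hp : ∀ n, blockStart F n = p n := by
    intro n
    induction n with
    | zero => rfl
    | succ n ih => rw [blockStart_succ, ih]
  refine ⟨F, funext fun k => ?_⟩
  obtain ⟨n, -, j, hj, rfl⟩ := exists_blockStart_add F (k + 1) k
    (Nat.lt_of_lt_of_le k.lt_succ_self (le_blockStart _ _))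
  rcases j with _ | j
  · rw [add_zero, blockEnc_start, hp]
  · have hj' : j ≤ (F n).2 := by omega
    rw [add_comm j 1, ← add_assoc, blockEnc_start_add_succ F n j hj', hp]
    rcases hj'.lt_or_eq with hlt | rfl
    · have := Nat.find_min (hx' (p n)) hlt
      simp only [Bool.not_eq_true] at this
      rw [this]
      simpa using hlt.ne
    · have := Nat.find_spec (hx' (p n))
      rw [this]
      simp

lemma countable_compl_range_blockEnc : (Set.range blockEnc)ᶜ.Countable := by
  have h : (Set.range blockEnc)ᶜ ⊆
      Set.range fun s : Finset ℕ => fun k => decide (k ∈ s) := by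
    intro x hx
    have : ¬ ∀ m, ∃ k ≥ m, x k = true := fun h => hx (mem_range_blockEnc h)
    push Not at this
    obtain ⟨m, hm⟩ := this
    refine ⟨(Finset.range m).filter fun k => x k = true, funext fun k => ?_⟩
    by_cases hk : x k = true
    · have : k < m := by
        by_contra hkm
        exact hm k (by omega) hk
      simp [this]
    · simp [hk]
  exact (Set.countable_range _).mono h

/-! ### Homogeneity of sets invariant under a dense group of translations -/

lemma exists_first_ne {B : Type*} {f x : ℕ → B} (h : x ≠ f) : ∃ m, x m ≠ f m ∧ ∀ l < m, x l = f l := by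
  classical
  have h' := Function.ne_iff.1 h
  exact ⟨Nat.find h', Nat.find_spec h', fun l hl => not_not.1 (Nat.find_min h' hl)⟩

section Patch

variable {A : Type*} [AddCommGroup A]

open Classical in
/-- Translate `x` by `q m`, where `m` is the first place at which `x` differs from `f`, and map
`f` to `g`. -/
noncomputable def patch (f g : ℕ → A) (q : ℕ → ℕ → A) (x : ℕ → A) (i : ℕ) : A :=
  if h : ∃ m, m ≤ i ∧ x m ≠ f m then x i + q (Nat.find h) i else g i

lemma patch_self (f g : ℕ → A) (q : ℕ → ℕ → A) : patch f g q f = g := by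
  funext i
  simp [patch]

/-- Below `m`, `x` agrees with `f` and `q m` with `g - f`, so the value `g i` is already the
translated one. -/
lemma patch_of_first_ne {f g : ℕ → A} {q : ℕ → ℕ → A} (hq : ∀ m, ∀ i ≤ m, q m i = g i - f i)
    {x : ℕ → A} {m : ℕ} (hm : x m ≠ f m) (hlt : ∀ l < m, x l = f l) :
    patch f g q x = x + q m := by
  classical
  funext i
  by_cases h : ∃ m, m ≤ i ∧ x m ≠ f m
  · have : Nat.find h = m := by
      refine (Nat.find_eq_iff h).2 ⟨⟨?_, hm⟩, fun l hl hl' => hl'.2 (hlt l hl)⟩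
      obtain ⟨l, hl, hne⟩ := h
      by_contra hmi
      exact hne (hlt l (by omega))
    simp only [patch, dif_pos h, Pi.add_apply]
    rw [← this]
  · have hi : i < m := by
      by_contra hmi
      exact h ⟨m, by omega, hm⟩
    simp only [patch, dif_neg h, Pi.add_apply]
    rw [hq m i hi.le, hlt i hi]
    abel

/-- The first place of difference is preserved: `x + q m` leaves `g` exactly where `x` leaves `f`.
-/
lemma patch_patch {f g : ℕ → A} {q : ℕ → ℕ → A} (hq : ∀ m, ∀ i ≤ m, q m i = g i - f i)
    (x : ℕ → A) : patch g f (-q) (patch f g q x) = x := by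
  by_cases h : x = f
  · rw [h, patch_self, patch_self]
  obtain ⟨m, hm, hlt⟩ := exists_first_ne h
  rw [patch_of_first_ne hq hm hlt, patch_of_first_ne (m := m)]
  · simp
  · intro m i hi
    simp [hq m i hi]
  · intro h'
    apply hm
    rw [Pi.add_apply, hq m m le_rfl] at h'
    have : x m - f m = x m + (g m - f m) - g m := by abel
    rw [h', sub_self] at this
    exact sub_eq_zero.1 this
  · intro l hl
    rw [Pi.add_apply, hq m l hl.le, hlt l hl]
    abel

lemma continuous_patch [TopologicalSpace A] [DiscreteTopology A] {f g : ℕ → A} {q : ℕ → ℕ → A} :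
    Continuous (patch f g q) := by
  classical
  refine continuous_of_prefix fun x i => ⟨i + 1, fun y hy => ?_⟩
  have hP : ∀ m, (m ≤ i ∧ y m ≠ f m) ↔ (m ≤ i ∧ x m ≠ f m) := fun m =>
    and_congr_right fun hm => by rw [hy m (by omega)]
  simp only [patch, hP, hy i i.lt_succ_self]

lemma topHomogeneous_of_dense_translations [TopologicalSpace A] [DiscreteTopology A]
    {Q : AddSubgroup (ℕ → A)} (hQ : ∀ (f : ℕ → A) n, ∃ q ∈ Q, ∀ i < n, q i = f i)
    {X : Set (ℕ → A)} (hX : ∀ x ∈ X, ∀ q ∈ Q, x + q ∈ X) : TopHomogeneous X := by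
  rintro ⟨f, hf⟩ ⟨g, hg⟩
  choose q hqQ hq using fun m => hQ (g - f) (m + 1)
  have hq' : ∀ m, ∀ i ≤ m, q m i = g i - f i := fun m i hi => hq m i (by omega)
  have hq'' : ∀ m, ∀ i ≤ m, (-q) m i = f i - g i := fun m i hi => by simp [hq' m i hi]
  have key : ∀ (f g : ℕ → A) (q : ℕ → ℕ → A), g ∈ X → (∀ m, q m ∈ Q) →
      (∀ m, ∀ i ≤ m, q m i = g i - f i) → ∀ x ∈ X, patch f g q x ∈ X := by
    intro f g q hg hqQ hq x hx
    by_cases h : x = f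
    · rwa [h, patch_self]
    obtain ⟨m, hm, hlt⟩ := exists_first_ne h
    rw [patch_of_first_ne hq hm hlt]
    exact hX x hx _ (hqQ m)
  have hinv : ∀ x, patch f g q (patch g f (-q) x) = x := fun x => by
    simpa using patch_patch hq'' x
  let h : (ℕ → A) ≃ₜ (ℕ → A) :=
    { toFun := patch f g q
      invFun := patch g f (-q)
      left_inv := patch_patch hq'
      right_inv := hinv
      continuous_toFun := continuous_patch
      continuous_invFun := continuous_patch }
  have hiff : ∀ x, x ∈ X ↔ h x ∈ X := fun x =>
    ⟨key f g q hg hqQ hq' x, fun hx => by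
      have := key g f (-q) hf (fun m => Q.neg_mem (hqQ m)) hq'' _ hx
      exact (patch_patch hq' x) ▸ this⟩
  exact ⟨h.subtype hiff, Subtype.ext (patch_self f g q)⟩

lemma TopHomogeneous.of_homeomorph {X Y : Type*} [TopologicalSpace X] [TopologicalSpace Y]
    (hX : TopHomogeneous X) (e : X ≃ₜ Y) : TopHomogeneous Y := fun x y => by
  obtain ⟨h, hh⟩ := hX (e.symm x) (e.symm y)
  exact ⟨(e.symm.trans h).trans e, by simp [hh]⟩

end Patch

/-! ### Choosing pairwise independent points -/

open Cardinal in
/-- From continuum many sets of size continuum one can choose points that pairwise avoid a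
symmetric relation with countable sections. -/
lemma exists_pairwise_choice {I α : Type} (hI : #I = 𝔠) (W : I → Set α) (hW : ∀ i, #(W i) = 𝔠)
    {C : α → α → Prop} (hsymm : ∀ a b, C a b → C b a)
    (hC : ∀ i a, {b ∈ W i | C a b}.Countable) :
    ∃ p : I → α, (∀ i, p i ∈ W i) ∧ ∀ i j, i ≠ j → ¬ C (p i) (p j) := by
  obtain ⟨r, hr, hord⟩ := exists_ord_eq I
  -- The well-order has minimal order type, so proper initial segments have fewer than `𝔠` elements.
  have hlt : ∀ i, #{j // r j i} < 𝔠 := fun i => hI ▸ card_typein_lt (r := r) i hord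
  have step : ∀ (i : I) (p : ∀ j, r j i → α), ∃ b ∈ W i, ∀ j (h : r j i), ¬ C (p j h) b := by
    intro i p
    by_contra! hcon
    have hsub : W i ⊆ ⋃ j : {j // r j i}, {b ∈ W i | C (p j j.2) b} := fun b hb => by
      obtain ⟨j, h, hj⟩ := hcon b hb
      exact Set.mem_iUnion.2 ⟨⟨j, h⟩, hb, hj⟩
    have h1 : 𝔠 ≤ #{j // r j i} * ℵ₀ := by
      rw [← hW i]
      refine (mk_le_mk_of_subset hsub).trans ((mk_iUnion_le _).trans ?_)
      gcongr
      exact ciSup_le' fun j => (hC i _).le_aleph0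
    exact absurd h1 (not_le.2 (mul_lt_of_lt aleph0_le_continuum (hlt i) aleph0_lt_continuum))
  choose F hFW hF using step
  let p : I → α := hr.wf.fix F
  have hp : ∀ i, p i = F i fun j _ => p j := fun i => hr.wf.fix_eq F i
  have hpC : ∀ i j, r j i → ¬ C (p j) (p i) := fun i j h => by
    rw [hp i]
    exact hF i (fun j _ => p j) j h
  refine ⟨p, fun i => hp i ▸ hFW i _, fun i j hij => ?_⟩
  rcases trichotomous_of r i j with h | h | h
  · exact hpC j i h
  · exact absurd h hij
  · exact fun h' => hpC i j h (hsymm _ _ h')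

/-- By the Borel isomorphism theorem; this makes continuum many choices available at every stage of
the recursion. -/
lemma MeasurableSet.mk_eq_continuum {α : Type} [MeasurableSpace α] [StandardBorelSpace α]
    {s : Set α} (hs : MeasurableSet s) (h : ¬ s.Countable) : Cardinal.mk s = Cardinal.continuum := by
  have := hs.standardBorel
  have h' : ¬ Countable s := h
  let e := PolishSpace.measurableEquivNatBoolOfNotCountable h'
  simpa using Cardinal.mk_congr e.toEquiv

/-! ### Transfinite construction of a translation invariant set -/

section Construction

/-- Failure at a fixed coordinate `n` is a closed condition on `(p, z)`, and projecting along the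
compact Cantor set keeps it closed. -/
lemma isGδ_forall_eq {P : Type*} [TopologicalSpace P] {u v : P → ℕ → Bool} (hu : Continuous u)
    (hv : Continuous v) {R : Set ((ℕ → Bool) × (ℕ → Bool))} (hR : IsClosed R) :
    IsGδ {p | ∀ z, (u p, z) ∈ R → z = v p} := by
  have : {p | ∀ z, (u p, z) ∈ R → z = v p} =
      ⋂ n, (Prod.fst '' {t : P × (ℕ → Bool) | (u t.1, t.2) ∈ R ∧ t.2 n ≠ v t.1 n})ᶜ := by
    ext p
    simp only [Set.mem_ofPred_eq, Set.mem_iInter, Set.mem_compl_iff, Set.mem_image, Prod.exists,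
      exists_and_right, exists_eq_right, not_exists, not_and, not_not, funext_iff]
    exact ⟨fun h n z hz => h z hz n, fun h z hz n => h n z hz⟩
  rw [this]
  refine IsGδ.iInter_of_isOpen fun n => (isClosedMap_fst_of_compactSpace _ ?_).isOpen_compl
  refine (hR.preimage (by fun_prop)).inter ?_
  have h1 : Continuous fun t : P × (ℕ → Bool) => (t.2 n, v t.1 n) := by fun_prop
  exact (isClosed_discrete {b : Bool × Bool | b.1 ≠ b.2}).preimage h1

variable {N : Type}

/-- Pairs `(f, g)` such that `E f` and `E g` are each other's only partners in the relation `R`. -/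
def strictPairs (E : N → ℕ → Bool) (R : Set ((ℕ → Bool) × (ℕ → Bool))) : Set (N × N) :=
  {p | (E p.1, E p.2) ∈ R ∧ (∀ z, (E p.1, z) ∈ R → z = E p.2) ∧ ∀ z, (z, E p.2) ∈ R → z = E p.1}

lemma isGδ_strictPairs [TopologicalSpace N] [PolishSpace N] {E : N → ℕ → Bool} (hE : Continuous E)
    {R : Set ((ℕ → Bool) × (ℕ → Bool))} (hR : IsClosed R) : IsGδ (strictPairs E R) := by
  let := TopologicalSpace.upgradeIsCompletelyMetrizable N
  have h1 : IsClosed {p : N × N | (E p.1, E p.2) ∈ R} := hR.preimage (by fun_prop)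
  exact h1.isGδ.inter ((isGδ_forall_eq (hE.comp continuous_fst) (hE.comp continuous_snd) hR).inter
    (isGδ_forall_eq (hE.comp continuous_snd) (hE.comp continuous_fst)
      (hR.preimage continuous_swap)))

lemma injOn_fst_strictPairs {E : N → ℕ → Bool} (hE : Function.Injective E)
    (R : Set ((ℕ → Bool) × (ℕ → Bool))) : Set.InjOn Prod.fst (strictPairs E R) := by
  rintro ⟨f, g⟩ h ⟨f', g'⟩ h' (rfl : f = f')
  exact Prod.ext rfl (hE (h'.2.1 _ h.1))

lemma injOn_snd_strictPairs {E : N → ℕ → Bool} (hE : Function.Injective E)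
    (R : Set ((ℕ → Bool) × (ℕ → Bool))) : Set.InjOn Prod.snd (strictPairs E R) := by
  rintro ⟨f, g⟩ h ⟨f', g'⟩ h' (rfl : g = g')
  exact Prod.ext (hE (h'.2.2 _ h.1)) rfl

variable [AddCommGroup N]

/-- Pairs having members in a common coset of `Q`. -/
def SharesCoset (Q : AddSubgroup N) (a b : N × N) : Prop :=
  (a.1 - b.1 ∈ Q ∨ a.2 - b.1 ∈ Q) ∨ (a.1 - b.2 ∈ Q ∨ a.2 - b.2 ∈ Q)

lemma SharesCoset.symm {Q : AddSubgroup N} {a b : N × N} (h : SharesCoset Q a b) :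
    SharesCoset Q b a := by
  simp only [SharesCoset, Q.sub_mem_comm_iff (a := b.1), Q.sub_mem_comm_iff (a := b.2)] at *
  tauto

lemma countable_sharesCoset {Q : AddSubgroup N} (hQ : (Q : Set N).Countable) {W : Set (N × N)}
    (h1 : Set.InjOn Prod.fst W) (h2 : Set.InjOn Prod.snd W) (a : N × N) :
    {b ∈ W | SharesCoset Q a b}.Countable := by
  have hT : ∀ c : N, {x | c - x ∈ Q}.Countable := fun c =>
    Set.MapsTo.countable_of_injOn (f := fun x => c - x) (t := (Q : Set N)) (fun x hx => hx)
      (fun x _ y _ h => sub_right_injective h) hQ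
  have hT' := (hT a.1).union (hT a.2)
  have h1' : {b ∈ W | a.1 - b.1 ∈ Q ∨ a.2 - b.1 ∈ Q}.Countable :=
    Set.MapsTo.countable_of_injOn (fun b hb => hb.2) (h1.mono fun b hb => hb.1) hT'
  have h2' : {b ∈ W | a.1 - b.2 ∈ Q ∨ a.2 - b.2 ∈ Q}.Countable :=
    Set.MapsTo.countable_of_injOn (fun b hb => hb.2) (h2.mono fun b hb => hb.1) hT'
  refine (h1'.union h2').mono ?_
  rintro b ⟨hb, h | h⟩
  · exact Or.inl ⟨hb, h⟩
  · exact Or.inr ⟨hb, h⟩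

variable [TopologicalSpace N] [PolishSpace N] [IsTopologicalAddGroup N] [Uncountable N]

/-- There is a translation invariant set with everywhere uncountable complement that splits a
pair from every relation having uncountably many strict pairs in different cosets. -/
lemma exists_splitting_set {Q : AddSubgroup N} (hQ : (Q : Set N).Countable)
    (hQd : Dense (Q : Set N)) {E : N → ℕ → Bool} (hE : Continuous E)
    (hEinj : Function.Injective E) :
    ∃ X : Set N, (∀ x ∈ X, ∀ q ∈ Q, x + q ∈ X) ∧
      (∀ s : ℕ → (ℕ → Bool) × (ℕ → Bool),
        ¬ (strictPairs E (closure (Set.range s)) ∩ {p | p.2 - p.1 ∉ Q}).Countable →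
        ∃ p ∈ strictPairs E (closure (Set.range s)), p.1 ∉ X ∧ p.2 ∈ X) ∧
      ∀ O : Set N, IsOpen O → O.Nonempty → ¬ (O \ X).Countable := by
  classical
  obtain ⟨δ, hδ⟩ : ∃ δ, δ ∉ Q := by
    by_contra! h
    exact Set.not_countable_univ (hQ.mono fun x _ => h x)
  let : MeasurableSpace (N × N) := borel _
  have : BorelSpace (N × N) := ⟨rfl⟩
  let W₀ : (ℕ → (ℕ → Bool) × (ℕ → Bool)) → Set (N × N) := fun s =>
    strictPairs E (closure (Set.range s)) ∩ {p | p.2 - p.1 ∉ Q}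
  -- A default for codes with too few strict pairs: every index then selects a pair in different
  -- cosets, and continuum many indices remain available.
  let T : Set (N × N) := {p | p.2 = p.1 + δ}
  let W : (ℕ → (ℕ → Bool) × (ℕ → Bool)) → Set (N × N) := fun s =>
    if (W₀ s).Countable then T else W₀ s
  have hQc : ∀ s, MeasurableSet (W₀ s) := fun s => by
    refine (isGδ_strictPairs hE isClosed_closure).measurableSet.inter ?_
    have : {p : N × N | p.2 - p.1 ∉ Q} = ((fun p : N × N => p.2 - p.1) ⁻¹' (Q : Set N))ᶜ := rfl
    rw [this]
    let : MeasurableSpace N := borel _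
    have : BorelSpace N := ⟨rfl⟩
    have hc : Continuous fun p : N × N => p.2 - p.1 := by fun_prop
    exact (hc.measurable hQ.measurableSet).compl
  have hTm : MeasurableSet T :=
    (isClosed_eq (by fun_prop) (by fun_prop) : IsClosed T).measurableSet
  have hTc : ¬ T.Countable := fun h =>
    Set.not_countable_univ (Set.MapsTo.countable_of_injOn (f := fun x : N => (x, x + δ))
      (s := Set.univ) (fun _ _ => rfl) (fun x _ y _ h => congrArg Prod.fst h) h)
  have hW : ∀ s, Cardinal.mk (W s) = Cardinal.continuum ∧ Set.InjOn Prod.fst (W s) ∧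
      Set.InjOn Prod.snd (W s) ∧ ∀ p ∈ W s, p.2 - p.1 ∉ Q := by
    intro s
    by_cases h : (W₀ s).Countable
    · simp only [W, if_pos h]
      refine ⟨hTm.mk_eq_continuum hTc, ?_, ?_, ?_⟩
      · rintro ⟨f, g⟩ (h : g = f + δ) ⟨f', g'⟩ (h' : g' = f' + δ) (hf : f = f')
        rw [h, h', hf]
      · rintro ⟨f, g⟩ (h : g = f + δ) ⟨f', g'⟩ (h' : g' = f' + δ) (hf : g = g')
        rw [h, h', add_left_inj] at hf
        rw [h, h', hf]
      · rintro ⟨f, g⟩ (h : g = f + δ)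
        simpa [h] using hδ
    · simp only [W, if_neg h]
      exact ⟨(hQc s).mk_eq_continuum h,
        (injOn_fst_strictPairs hEinj _).mono Set.inter_subset_left,
        (injOn_snd_strictPairs hEinj _).mono Set.inter_subset_left, fun p hp => hp.2⟩
  have hI : Cardinal.mk (ℕ → (ℕ → Bool) × (ℕ → Bool)) = Cardinal.continuum := by simp
  obtain ⟨p, hpW, hpC⟩ := exists_pairwise_choice hI W (fun s => (hW s).1)
    (C := SharesCoset Q) (fun _ _ => SharesCoset.symm)
    fun s a => countable_sharesCoset hQ (hW s).2.1 (hW s).2.2.1 a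
  let X : Set N := {x | ∃ s, x - (p s).2 ∈ Q}
  have hX : ∀ x ∈ X, ∀ q ∈ Q, x + q ∈ X := by
    rintro x ⟨s, hs⟩ q hq
    refine ⟨s, ?_⟩
    rw [add_sub_right_comm]
    exact Q.add_mem hs hq
  have hfst : ∀ s, (p s).1 ∉ X := by
    rintro s ⟨t, ht⟩
    by_cases hst : s = t
    · subst hst
      exact (hW s).2.2.2 _ (hpW s) (Q.sub_mem_comm_iff.1 ht)
    · exact hpC s t hst (Or.inr (Or.inl ht))
  refine ⟨X, hX, fun s hs => ⟨p s, ?_, hfst s, s, by simp⟩, ?_⟩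
  · have := hpW s
    simp only [W, W₀, if_neg hs] at this
    exact this.1
  · intro O hO hne hcount
    -- The first members lie in pairwise distinct cosets outside `X`, and each coset meets `O` by
    -- density.
    have hq : ∀ s, ∃ q ∈ Q, (p s).1 + q ∈ O := fun s => by
      have hO' : IsOpen ((fun x => (p s).1 + x) ⁻¹' O) := hO.preimage (by fun_prop)
      obtain ⟨o, ho⟩ := hne
      obtain ⟨q, hq, hqQ⟩ := hQd.inter_open_nonempty _ hO' ⟨-(p s).1 + o, by simpa using ho⟩
      exact ⟨q, hqQ, hq⟩
    choose q hqQ hqO using hq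
    have : (Set.univ : Set (ℕ → (ℕ → Bool) × (ℕ → Bool))).Countable := by
      refine Set.MapsTo.countable_of_injOn (f := fun s => (p s).1 + q s) (t := O \ X) ?_ ?_ hcount
      · intro s _
        refine ⟨hqO s, fun h => hfst s ?_⟩
        simpa using hX _ h _ (Q.neg_mem (hqQ s))
      · intro s _ t _ hst
        by_contra hne
        refine hpC s t hne (Or.inl (Or.inl ?_))
        have : (p s).1 - (p t).1 = q t - q s := by
          simp only at hst
          rw [sub_eq_sub_iff_add_eq_add, hst, add_comm]
        rw [this]
        exact Q.sub_mem (hqQ t) (hqQ s)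
    have h' : Countable (ℕ → (ℕ → Bool) × (ℕ → Bool)) := Set.countable_univ_iff.1 this
    rw [← Cardinal.mk_le_aleph0_iff, hI] at h'
    exact absurd h' (not_le.2 Cardinal.aleph0_lt_continuum)

end Construction

/-! ### Rigidity of the complement -/

lemma exists_seq_closure_range_eq {Z : Type*} [TopologicalSpace Z] [SecondCountableTopology Z]
    {S : Set Z} (hS : S.Nonempty) : ∃ s : ℕ → Z, closure (Set.range s) = closure S := by
  have := hS.to_subtype
  obtain ⟨u, hu⟩ := TopologicalSpace.exists_dense_seq S
  refine ⟨fun n => u n, subset_antisymm (closure_mono ?_) (closure_minimal ?_ isClosed_closure)⟩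
  · rintro _ ⟨n, rfl⟩
    exact (u n).2
  · have h : S ⊆ closure (Subtype.val '' Set.range u) := Subtype.dense_iff.1 hu
    rwa [← Set.range_comp] at h

/-- The closure of the graph of a continuous partial function adds no values over the domain. -/
lemma eq_of_mem_closure_graph {Z Z' : Type*} [TopologicalSpace Z] [TopologicalSpace Z'] [T2Space Z']
    {Y : Set Z} {φ : Y → Z'} (hφ : Continuous φ) {x : Z} {z : Z'}
    (h : (x, z) ∈ closure (Set.range fun y : Y => (y.1, φ y))) (hx : x ∈ Y) : z = φ ⟨x, hx⟩ := by
  by_contra hne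
  obtain ⟨V, V', hV, hV', hzV, hxV', hdisj⟩ := t2_separation hne
  obtain ⟨O, hO, hOV⟩ := isOpen_induced_iff.1 (hV'.preimage hφ)
  have hxO : (⟨x, hx⟩ : Y) ∈ Subtype.val ⁻¹' O := hOV ▸ hxV'
  obtain ⟨-, ⟨hyO, hyV⟩, y, rfl⟩ := mem_closure_iff.1 h _ (hO.prod hV) ⟨hxO, hzV⟩
  have : y ∈ φ ⁻¹' V' := hOV ▸ hyO
  exact hdisj.ne_of_mem hyV this rfl

section Rigidity

variable {N : Type} [AddCommGroup N] [TopologicalSpace N] [PolishSpace N] [ContinuousAdd N]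

lemma topRigid_compl_image {Q : AddSubgroup N} (hQ : (Q : Set N).Countable) {E : N → ℕ → Bool}
    (hE : Topology.IsEmbedding E) (hEd : DenseRange E) (hEc : (Set.range E)ᶜ.Countable)
    (hosc : ∀ q ∈ Q, q ≠ 0 → ∀ U : Set (ℕ → Bool), IsOpen U → U.Nonempty →
      ∃ d ∈ U, d ∉ Set.range E ∧ ∃ k, ∀ U' : Set (ℕ → Bool), IsOpen U' → d ∈ U' →
        ∀ b, ∃ f, E f ∈ U' ∧ E (f + q) k = b)
    {X : Set N}
    (hsplit : ∀ s : ℕ → (ℕ → Bool) × (ℕ → Bool),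
      ¬ (strictPairs E (closure (Set.range s)) ∩ {p | p.2 - p.1 ∉ Q}).Countable →
      ∃ p ∈ strictPairs E (closure (Set.range s)), p.1 ∉ X ∧ p.2 ∈ X)
    (hX : ∀ O : Set N, IsOpen O → O.Nonempty → ¬ (O \ X).Countable) :
    TopRigid ((E '' X)ᶜ : Set (ℕ → Bool)) := by
  set Y : Set (ℕ → Bool) := (E '' X)ᶜ
  intro φ
  by_contra hφ
  have hEY : ∀ {f}, f ∉ X → E f ∈ Y := fun hf => by
    rintro ⟨f', hf', h⟩
    exact hf (hE.injective h ▸ hf')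
  obtain ⟨y₀, hy₀⟩ : ∃ y₀, φ y₀ ≠ y₀ := by
    by_contra! h
    exact hφ (Homeomorph.ext h)
  obtain ⟨k, hk⟩ := Function.ne_iff.1 (Subtype.coe_injective.ne hy₀)
  have hval : Continuous fun y : Y => (y.1, (φ y).1) :=
    continuous_subtype_val.prodMk (continuous_subtype_val.comp φ.continuous)
  -- the closure of the graph of `φ` over the open set where it changes the `k`-th coordinate
  let U : Set Y := {y | (φ y).1 k ≠ y.1 k}
  have hU : IsOpen U := by
    have : Continuous fun y : Y => ((φ y).1 k, y.1 k) :=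
      ((continuous_apply k).comp hval.snd).prodMk ((continuous_apply k).comp hval.fst)
    exact (isOpen_discrete {b : Bool × Bool | b.1 ≠ b.2}).preimage this
  obtain ⟨s, hs⟩ := exists_seq_closure_range_eq (S := (fun y : Y => (y.1, (φ y).1)) '' U)
    ⟨_, y₀, hk, rfl⟩
  set R := closure (Set.range s)
  have hR1 : ∀ {x z}, (x, z) ∈ R → ∀ hx : x ∈ Y, z = φ ⟨x, hx⟩ := fun {x z} h hx =>
    eq_of_mem_closure_graph (φ := fun y => (φ y).1) hval.snd
      (closure_mono (Set.image_subset_range _ _) (hs ▸ h)) hx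
  have hR2 : ∀ {x z}, (x, z) ∈ R → ∀ hz : z ∈ Y, x = φ.symm ⟨z, hz⟩ := fun {x z} h hz => by
    refine eq_of_mem_closure_graph (φ := fun y => (φ.symm y).1)
      (continuous_subtype_val.comp φ.symm.continuous) ?_ hz
    rw [hs] at h
    refine map_mem_closure (f := Prod.swap) continuous_swap h ?_
    rintro _ ⟨y, -, rfl⟩
    exact ⟨φ y, by simp⟩
  have hUR : ∀ y ∈ U, (y.1, (φ y).1) ∈ R := fun y hy => hs ▸ subset_closure ⟨y, hy, rfl⟩
  have hstrict : ∀ y ∈ U, ∀ f g, E f = y.1 → E g = (φ y).1 → (f, g) ∈ strictPairs E R := by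
    intro y hy f g hf hg
    refine ⟨?_, fun z hz => ?_, fun x hx => ?_⟩
    · simpa only [hf, hg] using hUR y hy
    · simp only [hf, hg] at hz ⊢
      exact hR1 hz y.2
    · simp only [hf, hg] at hx ⊢
      simpa using hR2 hx (φ y).2
  have hW : (strictPairs E R ∩ {p | p.2 - p.1 ∉ Q}).Countable := by
    by_contra h
    obtain ⟨p, hp, hp1, hp2⟩ := hsplit s h
    have := hR1 hp.1 (hEY hp1)
    exact (φ ⟨E p.1, hEY hp1⟩).2 (this ▸ Set.mem_image_of_mem E hp2)
  -- Injectivity of `φ` allows only countably many points to land in the countable remainder.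
  have hgood : ∀ G : Set N, IsOpen G → G.Nonempty →
      ¬ {f ∈ G | ∃ hf : E f ∈ Y, (φ ⟨E f, hf⟩).1 ∈ Set.range E}.Countable := by
    intro G hG hne hc
    refine hX G hG hne ((hc.union (t := {f | ∃ hf : E f ∈ Y, (φ ⟨E f, hf⟩).1 ∈ (Set.range E)ᶜ})
      ?_).mono ?_)
    · classical
      refine Set.MapsTo.countable_of_injOn
        (f := fun f => if hf : E f ∈ Y then (φ ⟨E f, hf⟩).1 else E f) ?_ ?_ hEc
      · rintro f ⟨hf, h⟩
        simpa [hf] using h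
      · rintro f ⟨hf, -⟩ g ⟨hg, -⟩ h
        simp only [dif_pos hf, dif_pos hg] at h
        have := φ.injective (Subtype.ext h)
        exact hE.injective (congrArg Subtype.val this)
    · rintro f ⟨hfG, hfX⟩
      by_cases h : (φ ⟨E f, hEY hfX⟩).1 ∈ Set.range E
      · exact Or.inl ⟨hfG, hEY hfX, h⟩
      · exact Or.inr ⟨hEY hfX, h⟩
  have hnon : ∀ O' : Set (ℕ → Bool), IsOpen O' → O'.Nonempty → (E ⁻¹' O').Nonempty := by
    intro O' hO' hne
    obtain ⟨-, hx, f, rfl⟩ := hEd.inter_open_nonempty O' hO' hne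
    exact ⟨f, hx⟩
  -- `R` is the closure of the graph over `U`, so near any strict pair there is an actual graph
  -- point, and by continuity a whole open set of them.
  have hloc : ∀ P : Set (N × N), IsOpen P → (P ∩ strictPairs E R).Nonempty →
      ∃ O' : Set (ℕ → Bool), IsOpen O' ∧ (∃ y : Y, y.1 ∈ O') ∧ (∀ y : Y, y.1 ∈ O' → y ∈ U ∧
        ∀ f g, E f = y.1 → E g = (φ y).1 → (f, g) ∈ P ∩ strictPairs E R) := by
    rintro P hP ⟨⟨f₀, g₀⟩, hp, hpR⟩
    obtain ⟨P', hP', rfl⟩ := (hE.prodMap hE).isInducing.isOpen_iff.1 hP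
    have h1 := hpR.1
    rw [hs] at h1
    obtain ⟨-, hy', y, hyU, rfl⟩ := mem_closure_iff.1 h1 P' hP' hp
    obtain ⟨O', hO', h⟩ := isOpen_induced_iff.1 (hU.inter (hP'.preimage hval))
    have h' : ∀ y : Y, y.1 ∈ O' ↔ y ∈ U ∧ (y.1, (φ y).1) ∈ P' := fun y => Set.ext_iff.1 h y
    refine ⟨O', hO', ⟨y, (h' y).2 ⟨hyU, hy'⟩⟩, fun y hy => ⟨((h' y).1 hy).1, fun f g hf hg =>
      ⟨?_, hstrict y ((h' y).1 hy).1 f g hf hg⟩⟩⟩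
    have := ((h' y).1 hy).2
    simpa [Prod.map, hf, hg] using this
  have hZne : (strictPairs E R).Nonempty := by
    obtain ⟨O', hO', h⟩ := isOpen_induced_iff.1 hU
    have hy₀' : y₀ ∈ Subtype.val ⁻¹' O' := h ▸ hk
    have hne := Set.nonempty_of_not_subset fun hsub =>
      hgood _ (hO'.preimage hE.continuous) (hnon O' hO' ⟨_, hy₀'⟩) (Set.countable_empty.mono hsub)
    obtain ⟨f, ⟨hfO, hf, g, hg⟩, -⟩ := hne
    have : (⟨E f, hf⟩ : Y) ∈ U := h ▸ hfO
    exact ⟨_, hstrict _ this f g rfl hg⟩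
  -- by the Baire category theorem, a nonempty open piece of the strict pairs is one point or
  -- lies on the graph of one translation
  obtain ⟨P, hP, hPne, hPc⟩ : ∃ P : Set (N × N), IsOpen P ∧ (P ∩ strictPairs E R).Nonempty ∧
      ((∃ w, P ∩ strictPairs E R ⊆ {w}) ∨
        ∃ q ∈ Q, ∀ p ∈ P ∩ strictPairs E R, p.2 = p.1 + q) := by
    set Z := strictPairs E R
    -- The closed sets below cover only `Z`, which suffices because `Z` is a dense Gδ in the Polish
    -- space `closure Z`.
    have : PolishSpace (closure Z) := isClosed_closure.polishSpace
    have := hQ.to_subtype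
    have := hW.to_subtype
    let F : Q ⊕ ↥(Z ∩ {p | p.2 - p.1 ∉ Q}) → Set (closure Z) :=
      Sum.elim (fun q => {c | c.1.2 = c.1.1 + q}) (fun w => {c | c.1 = w.1})
    have hF : ∀ i, IsClosed (F i) := by
      rintro (q | w)
      · exact isClosed_eq (by fun_prop) (by fun_prop)
      · exact isClosed_eq (by fun_prop) (by fun_prop)
    have hG : IsGδ (Subtype.val ⁻¹' Z : Set (closure Z)) :=
      (isGδ_strictPairs hE.continuous isClosed_closure).preimage continuous_subtype_val
    have hd : Dense (Subtype.val ⁻¹' Z : Set (closure Z)) := by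
      rw [Subtype.dense_iff, Subtype.image_preimage_coe, Set.inter_eq_right.2 subset_closure]
    have hcov : (Subtype.val ⁻¹' Z : Set (closure Z)) ⊆ ⋃ i, F i := by
      intro c hc
      rw [Set.mem_iUnion]
      by_cases h : c.1.2 - c.1.1 ∈ Q
      · exact ⟨Sum.inl ⟨_, h⟩, by simp [F]⟩
      · exact ⟨Sum.inr ⟨c.1, hc, h⟩, rfl⟩
    have hdense := hG.dense_iUnion_interior_of_closed hd hF hcov
    obtain ⟨z, hz⟩ := hZne
    have : Nonempty (closure Z) := ⟨⟨z, subset_closure hz⟩⟩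
    obtain ⟨c, hc⟩ := hdense.nonempty
    obtain ⟨i, hi⟩ := Set.mem_iUnion.1 hc
    obtain ⟨P, hP, hPi⟩ := isOpen_induced_iff.1 (isOpen_interior (s := F i))
    have hPF : ∀ p (hp : p ∈ P ∩ Z), (⟨p, subset_closure hp.2⟩ : closure Z) ∈ F i := by
      intro p hp
      refine interior_subset (s := F i) ?_
      rw [← hPi]
      exact hp.1
    have hcP : c ∈ Subtype.val ⁻¹' P := hPi ▸ hi
    refine ⟨P, hP, mem_closure_iff.1 c.2 P hP hcP, ?_⟩
    rcases i with q | w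
    · exact Or.inr ⟨q, q.2, fun p hp => hPF p hp⟩
    · exact Or.inl ⟨w, fun p hp => hPF p hp⟩
  obtain ⟨O', hO', ⟨y, hy⟩, hO'P⟩ := hloc P hP hPne
  rcases hPc with ⟨w, hw⟩ | ⟨q, hq, hPq⟩
  · refine hgood _ (hO'.preimage hE.continuous) (hnon O' hO' ⟨_, hy⟩)
      ((Set.countable_singleton w.1).mono ?_)
    rintro f ⟨hfO, hf, g, hg⟩
    exact congrArg Prod.fst (hw ((hO'P ⟨E f, hf⟩ hfO).2 f g rfl hg))
  have hq' : ∀ f, E f ∈ O' → ∀ hf : E f ∈ Y, (φ ⟨E f, hf⟩).1 ∈ Set.range E →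
      (φ ⟨E f, hf⟩).1 = E (f + q) := by
    rintro f hfO hf ⟨g, hg⟩
    rw [← hg, ← hPq _ ((hO'P ⟨E f, hf⟩ hfO).2 f g rfl hg)]
  have hq0 : q ≠ 0 := by
    rintro rfl
    refine hgood _ (hO'.preimage hE.continuous) (hnon O' hO' ⟨_, hy⟩)
      (Set.countable_empty.mono ?_)
    rintro f ⟨hfO, hf, hr⟩
    have h1 := hq' f hfO hf hr
    refine (hO'P ⟨E f, hf⟩ hfO).1 ?_
    rw [h1, add_zero]
  obtain ⟨d, hdO, hdE, k', hd⟩ := hosc q hq hq0 O' hO' ⟨_, hy⟩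
  have hdY : d ∈ Y := fun h => hdE (Set.image_subset_range _ _ h)
  have hO₂ : IsOpen {y : Y | (φ y).1 k' = (φ ⟨d, hdY⟩).1 k'} :=
    (isOpen_discrete {(φ ⟨d, hdY⟩).1 k'}).preimage ((continuous_apply k').comp hval.snd)
  obtain ⟨O₂, hO₂', h₂⟩ := isOpen_induced_iff.1 hO₂
  have h₂' : ∀ y : Y, y.1 ∈ O₂ ↔ (φ y).1 k' = (φ ⟨d, hdY⟩).1 k' := fun y => Set.ext_iff.1 h₂ y
  obtain ⟨f₁, hf₁, hf₁'⟩ := hd (O' ∩ O₂) (hO'.inter hO₂') ⟨hdO, (h₂' ⟨d, hdY⟩).2 rfl⟩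
    (!(φ ⟨d, hdY⟩).1 k')
  -- On this open set continuity of `φ` at `d` fixes bit `k'`, while translation by `q` gives the
  -- opposite bit.
  have hG : IsOpen {f : N | E f ∈ O' ∩ O₂ ∧ E (f + q) k' = !(φ ⟨d, hdY⟩).1 k'} := by
    refine ((hO'.inter hO₂').preimage hE.continuous).inter ?_
    have hcont : Continuous fun f : N => E (f + q) k' :=
      (continuous_apply k').comp (hE.continuous.comp (continuous_add_const q))
    exact (isOpen_discrete {!(φ ⟨d, hdY⟩).1 k'}).preimage hcont
  refine hgood _ hG ⟨f₁, hf₁, hf₁'⟩ (Set.countable_empty.mono ?_)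
  rintro f ⟨⟨⟨hfO, hfO₂⟩, hfk⟩, hf, hr⟩
  have h1 := (h₂' ⟨E f, hf⟩).1 hfO₂
  rw [hq' f hfO hf hr, hfk] at h1
  simp at h1

end Rigidity

/-! ### The group of polynomial sequences -/

section Polynomials

variable {A : Type} [Field A]

/-- The additive group of sequences `n ↦ p n` with `p` a polynomial. -/
noncomputable def polySeq (A : Type) [Field A] : AddSubgroup (ℕ → A) :=
  AddMonoidHom.range
    (AddMonoidHom.mk' (fun (p : Polynomial A) (n : ℕ) => p.eval (n : A)) fun p q => by
      funext n; simp)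

lemma mem_polySeq {f : ℕ → A} :
    f ∈ polySeq A ↔ ∃ p : Polynomial A, (fun n : ℕ => p.eval (n : A)) = f := Iff.rfl

lemma countable_polySeq [Countable A] : (polySeq A : Set (ℕ → A)).Countable := by
  have : Countable (Polynomial A) := by
    rw [← Cardinal.mk_le_aleph0_iff]
    exact Polynomial.cardinalMk_le_max.trans (by simp)
  exact Set.countable_range _

lemma exists_mem_polySeq_eq [CharZero A] (f : ℕ → A) (n : ℕ) :
    ∃ q ∈ polySeq A, ∀ i < n, q i = f i := by
  refine ⟨_, mem_polySeq.2 ⟨Lagrange.interpolate (Finset.range n) (fun i : ℕ => (i : A)) f, rfl⟩,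
    fun i hi => ?_⟩
  exact Lagrange.eval_interpolate_at_node f (fun a _ b _ h => Nat.cast_injective h)
    (Finset.mem_range.2 hi)

/-- This is why polynomials are used: finitely supported sequences also realise all prefixes, but
they vanish eventually, whereas oscillation needs nonzero entries arbitrarily far out. -/
lemma exists_ge_ne_zero_of_mem_polySeq [CharZero A] {q : ℕ → A} (hq : q ∈ polySeq A) (h0 : q ≠ 0)
    (m : ℕ) : ∃ n ≥ m, q n ≠ 0 := by
  obtain ⟨p, rfl⟩ := mem_polySeq.1 hq
  by_contra! h
  refine h0 ?_
  have : p = 0 := by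
    refine Polynomial.eq_zero_of_infinite_isRoot p
      (((Set.Ici_infinite m).image (Nat.cast_injective (R := A)).injOn).mono ?_)
    rintro _ ⟨n, hn, rfl⟩
    exact h n hn
  funext n
  simp [this]

lemma dense_polySeq [CharZero A] [TopologicalSpace A] [DiscreteTopology A] :
    Dense (polySeq A : Set (ℕ → A)) := by
  refine dense_iff_inter_open.2 fun U hU ⟨f, hf⟩ => ?_
  obtain ⟨n, hn⟩ := exists_prefix_subset hU hf
  obtain ⟨q, hq, h⟩ := exists_mem_polySeq_eq f n
  exact ⟨q, hn q h, hq⟩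

end Polynomials

/-! ### Oscillation of translations at the ends of blocks -/

section Oscillation

variable {A : Type} [Field A] [LinearOrder A] [IsStrictOrderedRing A]

lemma exists_sign_code [Countable A] : ∃ c : A ≃ Bool × ℕ, ∀ a, (c a).1 = decide (a < 0) := by
  have hinf : ∀ b : Bool, Infinite {a : A // decide (a < 0) = b} := by
    intro b
    cases b
    · refine Infinite.of_injective (fun n : ℕ => ⟨(n : A), by simp⟩) fun m n h => ?_
      simpa using h
    · refine Infinite.of_injective (fun n : ℕ => ⟨-((n : A) + 1), ?_⟩) fun m n h => ?_
      · simpa using neg_one_lt_zero.trans_le (Nat.cast_nonneg (α := A) n)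
      · simpa using h
  have e : ∀ b : Bool, Nonempty ({a : A // decide (a < 0) = b} ≃ ℕ) := fun b =>
    have := hinf b
    nonempty_equiv_of_countable
  let e' := fun b => (e b).some
  refine ⟨((Equiv.sigmaFiberEquiv fun a : A => decide (a < 0)).symm.trans
    (Equiv.sigmaCongrRight e')).trans (Equiv.sigmaEquivProd Bool ℕ), fun a => rfl⟩

/-- Translation by a nonzero `t` does not respect one of the two ends of `A`. -/
lemma infinite_sign_change {t : A} (ht : t ≠ 0) (b : Bool) :
    {a : A | decide (a < 0) = decide (0 < t) ∧ decide (a + t < 0) = b}.Infinite := by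
  rcases ht.lt_or_gt with ht | ht
  · cases b
    · refine (Set.Ici_infinite (-t)).mono fun a (ha : -t ≤ a) => ⟨?_, ?_⟩
      · simp only [ht.not_gt, decide_false, decide_eq_false_iff_not, not_lt]
        linarith
      · simp only [decide_eq_false_iff_not, not_lt]
        linarith
    · refine (Set.Ioo_infinite (a := 0) (b := -t) (by linarith)).mono fun a ha => ⟨?_, ?_⟩
      · simpa [ht.not_gt] using ha.1.le
      · simp only [decide_eq_true_eq]
        linarith [ha.2]
  · cases b
    · refine (Set.Ioo_infinite (a := -t) (b := 0) (by linarith)).mono fun a ha => ⟨?_, ?_⟩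
      · simpa [ht] using ha.2
      · simp only [decide_eq_false_iff_not, not_lt]
        linarith [ha.1]
    · refine (Set.Iio_infinite (-t)).mono fun a (ha : a < -t) => ⟨?_, ?_⟩
      · simp only [ht, decide_true, decide_eq_true_eq]
        linarith
      · simp only [decide_eq_true_eq]
        linarith

lemma exists_prefix_eq_blockEnc (x : ℕ → Bool) (m : ℕ) : ∃ F, ∀ k < m, blockEnc F k = x k := by
  obtain ⟨F, hF⟩ := mem_range_blockEnc (x := fun k => if k < m then x k else true)
    fun n => ⟨n + m, by omega, by simp⟩
  exact ⟨F, fun k hk => by simp [hF, hk]⟩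

lemma exists_oscillation {c : A ≃ Bool × ℕ} (hc : ∀ a, (c a).1 = decide (a < 0)) {q : ℕ → A}
    (hq : ∀ m, ∃ n ≥ m, q n ≠ 0) {U : Set (ℕ → Bool)} (hU : IsOpen U) (hne : U.Nonempty) :
    ∃ d ∈ U, (d ∉ Set.range fun f : ℕ → A => blockEnc fun n => c (f n)) ∧
      ∃ k, ∀ U' : Set (ℕ → Bool), IsOpen U' → d ∈ U' →
        ∀ b, ∃ f : ℕ → A, (blockEnc fun n => c (f n)) ∈ U' ∧
          blockEnc (fun n => c ((f + q) n)) k = b := by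
  classical
  obtain ⟨x, hx⟩ := hne
  obtain ⟨m, hm⟩ := exists_prefix_subset hU hx
  obtain ⟨F, hF⟩ := exists_prefix_eq_blockEnc x m
  obtain ⟨n, hnm, hqn⟩ := hq m
  let f : ℕ → A := fun i => c.symm (F i)
  -- The limit of encodings whose `n`-th entry has a fixed sign and code tending to infinity; the
  -- sign is the one on which adding `q n` can give either sign.
  let d : ℕ → Bool := fun k =>
    if k < blockStart F n then blockEnc F k
    else if k = blockStart F n then decide (0 < q n) else false
  have hmn := hnm.trans (le_blockStart F n)
  refine ⟨d, hm d fun i hi => ?_, ?_, blockStart (fun i => c ((f + q) i)) n, ?_⟩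
  · rw [← hF i hi]
    exact if_pos (by omega)
  · rintro ⟨g, hg⟩
    obtain ⟨k, hk, h⟩ := exists_blockEnc_eq_true (fun i => c (g i)) (blockStart F n + 1)
    have h' : d k = true := (congrFun hg k) ▸ h
    simp only [d] at h'
    rw [if_neg (by omega), if_neg (by omega)] at h'
    exact Bool.false_ne_true h'
  · intro U' hU' hd b
    obtain ⟨M, hM⟩ := exists_prefix_subset hU' hd
    -- Only finitely many codes have second component below `M`, whereas infinitely many entries
    -- give the required signs.
    obtain ⟨a, ⟨ha1, ha2⟩, haM⟩ : ∃ a ∈ {a : A | decide (a < 0) = decide (0 < q n) ∧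
        decide (a + q n < 0) = b}, M ≤ (c a).2 := by
      by_contra! hcon
      refine infinite_sign_change hqn b (((Set.toFinite (Set.univ : Set Bool)).prod
        (Set.finite_lt_nat M)).preimage c.injective.injOn |>.subset fun a ha => ?_)
      exact ⟨Set.mem_univ _, hcon a ha⟩
    let g : ℕ → A := fun i => if i = n then a else f i
    have hgf : ∀ i < n, g i = f i := fun i hi => if_neg hi.ne
    have hgn : g n = a := if_pos rfl
    have hgF : ∀ i < n, (fun i => c (g i)) i = F i := fun i hi => by simp [hgf i hi, f]
    have hs : blockStart (fun i => c (g i)) n = blockStart F n := blockStart_congr hgF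
    refine ⟨g, hM _ fun k hk => ?_, ?_⟩
    · simp only [d]
      split_ifs with h1 h2
      · exact blockEnc_congr hgF (hs ▸ h1)
      · rw [h2, ← hs, blockEnc_start, hgn, hc, ha1]
      · have : k = blockStart (fun i => c (g i)) n + 1 + (k - blockStart F n - 1) := by omega
        rw [this, blockEnc_start_add_succ _ _ _ (by simp only [hgn]; omega)]
        simp only [hgn, decide_eq_false_iff_not]
        omega
    -- The observed position depends only on entries before `n`, hence not on `a`.
    · have : blockStart (fun i => c ((f + q) i)) n = blockStart (fun i => c ((g + q) i)) n :=
        blockStart_congr fun i hi => by simp [hgf i hi]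
      rw [this, blockEnc_start, hc, ← ha2]
      simp [hgn]

end Oscillation

lemma uncountable_nat_pi {B : Type} [Nontrivial B] : Uncountable (ℕ → B) := by
  rw [← Cardinal.aleph0_lt_mk_iff]
  obtain ⟨x, y, hxy⟩ := exists_pair_ne B
  have hle : Cardinal.mk (ℕ → Bool) ≤ Cardinal.mk (ℕ → B) := by
    refine Cardinal.mk_le_of_injective (f := fun b n => if b n then x else y) fun b b' h => ?_
    funext n
    have h' := congrFun h n
    cases hb : b n <;> cases hb' : b' n <;> simp_all [hxy.symm]
  exact Cardinal.aleph0_lt_continuum.trans_le (by simpa using hle)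

/-- The space of sequences in `A` embeds into the Cantor set with countable remainder, at which
translations by nonzero polynomial sequences oscillate. -/
lemma exists_oscillating_embedding (A : Type) [Field A] [LinearOrder A] [IsStrictOrderedRing A]
    [Countable A] [TopologicalSpace A] [DiscreteTopology A] :
    ∃ E : (ℕ → A) → ℕ → Bool, Topology.IsEmbedding E ∧ DenseRange E ∧ (Set.range E)ᶜ.Countable ∧
      ∀ q ∈ polySeq A, q ≠ 0 → ∀ U : Set (ℕ → Bool), IsOpen U → U.Nonempty →
        ∃ d ∈ U, d ∉ Set.range E ∧ ∃ k, ∀ U' : Set (ℕ → Bool), IsOpen U' → d ∈ U' →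
          ∀ b, ∃ f, E f ∈ U' ∧ E (f + q) k = b := by
  obtain ⟨c, hc⟩ := exists_sign_code (A := A)
  let e : (ℕ → A) ≃ₜ (ℕ → Bool × ℕ) :=
    Homeomorph.piCongrRight fun _ => ⟨c, continuous_of_discreteTopology,
      continuous_of_discreteTopology⟩
  let E : (ℕ → A) → ℕ → Bool := fun f => blockEnc fun n => c (f n)
  have hrange : Set.range E = Set.range blockEnc := e.surjective.range_comp blockEnc
  refine ⟨E, isEmbedding_blockEnc.comp e.isEmbedding, ?_, hrange ▸ countable_compl_range_blockEnc,
    fun q hq h0 U hU hne =>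
      exists_oscillation hc (exists_ge_ne_zero_of_mem_polySeq hq h0) hU hne⟩
  rw [DenseRange, hrange]
  refine dense_iff_inter_open.2 fun U hU ⟨x, hx⟩ => ?_
  obtain ⟨m, hm⟩ := exists_prefix_subset hU hx
  obtain ⟨F, hF⟩ := exists_prefix_eq_blockEnc x m
  exact ⟨_, hm _ hF, F, rfl⟩

lemma dense_compl_image {N K : Type*} [TopologicalSpace N] [TopologicalSpace K] {E : N → K}
    (hE : Continuous E) (hinj : Function.Injective E) (hEd : DenseRange E) {X : Set N}
    (hX : ∀ O : Set N, IsOpen O → O.Nonempty → ¬ (O \ X).Countable) : Dense (E '' X)ᶜ := by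
  refine dense_iff_inter_open.2 fun U hU hne => ?_
  obtain ⟨-, hx, f, rfl⟩ := hEd.inter_open_nonempty U hU hne
  obtain ⟨g, ⟨hg, hgX⟩, -⟩ := Set.nonempty_of_not_subset fun h =>
    hX _ (hU.preimage hE) ⟨f, hx⟩ (Set.countable_empty.mono h)
  refine ⟨E g, hg, ?_⟩
  rintro ⟨g', hg', h⟩
  exact hgX (hinj h ▸ hg')

lemma exists_homogeneous_rigid_compl (A : Type) [Field A] [LinearOrder A] [IsStrictOrderedRing A]
    [Countable A] [TopologicalSpace A] [DiscreteTopology A] :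
    ∃ X : Set (ℕ → Bool), TopHomogeneous (X : Type) ∧ Dense (Xᶜ : Set (ℕ → Bool)) ∧
      TopRigid ((Xᶜ : Set (ℕ → Bool)) : Type) := by
  have : PolishSpace A := inferInstance
  have : Uncountable (ℕ → A) := uncountable_nat_pi
  obtain ⟨E, hE, hEd, hEc, hosc⟩ := exists_oscillating_embedding A
  have hsplitting := exists_splitting_set (N := ℕ → A) (Q := polySeq A) (E := E)
    countable_polySeq dense_polySeq hE.continuous hE.injective
  obtain ⟨X, hXQ, hsplit, hX⟩ := hsplitting
  have hhom : TopHomogeneous X :=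
    topHomogeneous_of_dense_translations (Q := polySeq A) exists_mem_polySeq_eq hXQ
  have hrig : TopRigid ((E '' X)ᶜ : Set (ℕ → Bool)) :=
    topRigid_compl_image (Q := polySeq A) countable_polySeq hE hEd hEc hosc hsplit hX
  exact ⟨E '' X, hhom.of_homeomorph (hE.homeomorphImage X),
    dense_compl_image hE.continuous hE.injective hEd hX, hrig⟩

theorem theorem3p1 :
    ∃ X : Set (ℕ → Bool),
      TopHomogeneous (X : Type) ∧
      Dense (Xᶜ : Set (ℕ → Bool)) ∧
      TopRigid ((Xᶜ : Set (ℕ → Bool)) : Type) :=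
  @exists_homogeneous_rigid_compl ℚ _ _ _ _ ⊥ (discreteTopology_bot ℚ)
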